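/- **Theorem (Lascoux polynomials into Lascoux atoms).** Let $n\ge 0$ and work in $\mathbb{Z}[\beta][x_1,\dots,x_n]$. For $1\le i<n$ let $s_i$ act on polynomials by exchanging $x_i$ and $x_{i+1}$, and define operators $$\partial_i f=\frac{f-s_i f}{x_i-x_{i+1}},\qquad \pi_i f=\partial_i(x_i f),\qquad \tau_i f=\pi_i\big((1+\beta x_{i+1})f\big),\qquad \hat\tau_i f=\tau_i f-f .$$ For $w\in S_n$ and any reduced word $w=s_{a_1}\cdots s_{a_k}$ put $\tau_w=\tau_{a_1}\cdots\tau_{a_k}$ and $\hat\tau_w=\hat\tau_{a_1}\cdots\hat\tau_{a_k}$. For a weak composition $\gamma=(\gamma_1,\dots,\gamma_n)\in\mathbb{Z}_{\ge 0}^n$ let $\lambda(\gamma)$ be its weakly decreasing rearrangement, let $w(\gamma)\in S_n$ be the shortest permutation sending $\lambda(\gamma)$ to $\gamma$ (that is, the shortest $w$ with $\gamma_{w(i)}=\lambda(\gamma)_i$ for all $i$), and let $$\Omega_\gamma=\tau_{w(\gamma)}x^{\lambda(\gamma)},\qquad \hat{\mathcal L}_\gamma=\hat\tau_{w(\gamma)}x^{\lambda(\gamma)},\qquad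 x^\lambda=x_1^{\lambda_1}\cdots x_n^{\lambda_n}.$$ Then for every weak composition $\delta\in\mathbb{Z}_{\ge 0}^n$, $$\Omega_\delta=\sum_{\gamma\le\delta}\hat{\mathcal L}_\gamma ,$$ where the sum is over all weak compositions $\gamma\in\mathbb{Z}_{\ge 0}^n$ with $\gamma\le\delta$, meaning that $\lambda(\gamma)=\lambda(\delta)$ and $w(\gamma)\le w(\delta)$ in the Bruhat order of $S_n$. The identity holds for every choice of the reduced words used to compute $\tau_{w(\delta)}$ and the $\hat\tau_{w(\gamma)}$. -/

import Mathlib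

/-!  Lascoux polynomials and Lascoux atoms in `n` variables, over `ℤ[β]`.
Positions and variables are indexed from `0`, so `i : Fin (n - 1)` stands for the pair of
neighbouring positions `i, i + 1`. -/

namespace Lascoux

/-- The left one of the two neighbouring positions `i, i + 1`. -/
def lo {n : ℕ} (i : Fin (n - 1)) : Fin n := ⟨i.1, by omega⟩

/-- The right one of the two neighbouring positions `i, i + 1`. -/
def hi {n : ℕ} (i : Fin (n - 1)) : Fin n := ⟨i.1 + 1, by omega⟩

/-! ### The symmetric group: words, length, Bruhat order -/

/-- The simple transposition `s_i` exchanging `i` and `i + 1`. -/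
def simple {n : ℕ} (i : Fin (n - 1)) : Equiv.Perm (Fin n) := Equiv.swap (lo i) (hi i)

/-- The permutation `s_{a₁} ⋯ s_{aₖ}` spelled by a word `a₁ ⋯ aₖ`
(the rightmost factor acts first). -/
def wordProd {n : ℕ} (a : List (Fin (n - 1))) : Equiv.Perm (Fin n) := (a.map simple).prod

theorem exists_word {n : ℕ} (w : Equiv.Perm (Fin n)) :
    ∃ a : List (Fin (n - 1)), wordProd a = w := by
  cases n with
  | zero => exact ⟨[], Subsingleton.elim _ _⟩
  | succ m =>
    have h : w ∈ Submonoid.closure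
        (Set.range fun i : Fin m => Equiv.swap i.castSucc i.succ) := by
      rw [Equiv.Perm.mclosure_swap_castSucc_succ]; trivial
    induction h using Submonoid.closure_induction with
    | mem x hx =>
      obtain ⟨i, rfl⟩ := hx
      exact ⟨[i], by simp [wordProd, simple]; rfl⟩
    | one => exact ⟨[], rfl⟩
    | mul x y _ _ hx hy =>
      obtain ⟨a, rfl⟩ := hx
      obtain ⟨b, rfl⟩ := hy
      exact ⟨a ++ b, by simp [wordProd]⟩

/-- The length `ℓ(w)`: the least number of simple transpositions with product `w`. -/
noncomputable def permLength {n : ℕ} (w : Equiv.Perm (Fin n)) : ℕ :=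
  sInf {k : ℕ | ∃ a : List (Fin (n - 1)), wordProd a = w ∧ a.length = k}

/-- The reduced words of `w`. -/
def ReducedWord {n : ℕ} (w : Equiv.Perm (Fin n)) : Type :=
  {a : List (Fin (n - 1)) // wordProd a = w ∧ a.length = permLength w}

theorem nonempty_reducedWord {n : ℕ} (w : Equiv.Perm (Fin n)) : Nonempty (ReducedWord w) := by
  obtain ⟨a, ha⟩ := exists_word w
  obtain ⟨b, hb⟩ := Nat.sInf_mem
    (s := {k : ℕ | ∃ a : List (Fin (n - 1)), wordProd a = w ∧ a.length = k}) ⟨_, a, ha, rfl⟩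
  exact ⟨⟨b, hb⟩⟩

/-- Bruhat order on the symmetric group: `v ≤ w` if one gets from `v` to `w` by finitely many
multiplications by a transposition, each of which increases the length. -/
def BruhatLE {n : ℕ} (v w : Equiv.Perm (Fin n)) : Prop :=
  Relation.ReflTransGen
    (fun x y : Equiv.Perm (Fin n) =>
      (∃ t : Equiv.Perm (Fin n), t.IsSwap ∧ y = x * t) ∧ permLength x < permLength y) v w

/-! ### Weak compositions `γ : Fin n → ℕ` -/

/-- `λ(γ)`: the parts of `γ` in weakly decreasing order. -/
def sorted {n : ℕ} (γ : Fin n → ℕ) : Fin n → ℕ :=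
  γ ∘ Tuple.sort (OrderDual.toDual ∘ γ)

theorem sorted_antitone {n : ℕ} (γ : Fin n → ℕ) : Antitone (sorted γ) :=
  fun _ _ h => Tuple.monotone_sort (OrderDual.toDual ∘ γ) h

/-- The permutations that send `λ(γ)` to `γ`, where `w` moves the part in position `i` to position
`w i`; that is, `γ (w i) = λ(γ) i` for all `i`. -/
def sendingPerms {n : ℕ} (γ : Fin n → ℕ) : Set (Equiv.Perm (Fin n)) :=
  {w | ∀ i, γ (w i) = sorted γ i}

theorem sendingPerms_nonempty {n : ℕ} (γ : Fin n → ℕ) : (sendingPerms γ).Nonempty :=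
  ⟨Tuple.sort (OrderDual.toDual ∘ γ), fun _ => rfl⟩

/-- `w(γ)`: the shortest permutation that sends `λ(γ)` to `γ`. -/
noncomputable def compPerm {n : ℕ} (γ : Fin n → ℕ) : Equiv.Perm (Fin n) :=
  Function.argminOn permLength (sendingPerms γ) (sendingPerms_nonempty γ)

/-- `γ ≤ δ`: `λ(γ) = λ(δ)`, and `w(γ) ≤ w(δ)` in Bruhat order. -/
def CompLE {n : ℕ} (γ δ : Fin n → ℕ) : Prop :=
  sorted γ = sorted δ ∧ BruhatLE (compPerm γ) (compPerm δ)

theorem finite_compLE {n : ℕ} (δ : Fin n → ℕ) : {γ : Fin n → ℕ | CompLE γ δ}.Finite := by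
  refine (Set.finite_range fun σ : Equiv.Perm (Fin n) => sorted δ ∘ σ).subset ?_
  rintro γ ⟨h, -⟩
  refine ⟨(Tuple.sort (OrderDual.toDual ∘ γ))⁻¹, ?_⟩
  funext i
  change sorted δ ((Tuple.sort (OrderDual.toDual ∘ γ))⁻¹ i) = γ i
  rw [← h]
  simp [sorted]

/-- The finite set of all weak compositions `γ ≤ δ`. -/
noncomputable def compsBelow {n : ℕ} (δ : Fin n → ℕ) : Finset (Fin n → ℕ) :=
  (finite_compLE δ).toFinset

/-! ### Operators on `ℤ[β][x_1, …, x_n]` -/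

/-- The polynomial ring `ℤ[β][x_1, …, x_n]`. -/
abbrev Pol (n : ℕ) : Type := MvPolynomial (Fin n) (Polynomial ℤ)

/-- The parameter `β`. -/
noncomputable def beta (n : ℕ) : Pol n := MvPolynomial.C Polynomial.X

/-- `s_i` acting on polynomials by exchanging `x_i` and `x_{i+1}`. -/
noncomputable def swapVars {n : ℕ} (i : Fin (n - 1)) (f : Pol n) : Pol n :=
  MvPolynomial.rename (simple i) f

theorem dvd_sub_swapVars {n : ℕ} (i : Fin (n - 1)) (f : Pol n) :
    (MvPolynomial.X (lo i) - MvPolynomial.X (hi i) : Pol n) ∣ f - swapVars i f := by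
  induction f using MvPolynomial.induction_on with
  | C a => simp [swapVars]
  | add p q hp hq =>
    have : p + q - swapVars i (p + q) = (p - swapVars i p) + (q - swapVars i q) := by
      simp only [swapVars, map_add]; ring
    rw [this]; exact dvd_add hp hq
  | mul_X p j hp =>
    have hX : (MvPolynomial.X (lo i) - MvPolynomial.X (hi i) : Pol n) ∣
        MvPolynomial.X j - swapVars i (MvPolynomial.X j) := by
      simp only [swapVars, MvPolynomial.rename_X, simple]
      rcases eq_or_ne j (lo i) with rfl | h1
      · simp
      · rcases eq_or_ne j (hi i) with rfl | h2
        · rw [Equiv.swap_apply_right]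
          exact ⟨-1, by ring⟩
        · simp [Equiv.swap_apply_of_ne_of_ne h1 h2]
    have : p * MvPolynomial.X j - swapVars i (p * MvPolynomial.X j) =
        (p - swapVars i p) * MvPolynomial.X j +
          swapVars i p * (MvPolynomial.X j - swapVars i (MvPolynomial.X j)) := by
      simp only [swapVars, map_mul]; ring
    rw [this]; exact dvd_add (hp.mul_right _) (hX.mul_left _)

/-- The divided difference `∂_i f = (f - s_i f) / (x_i - x_{i+1})`, the quotient being exact. -/
noncomputable def divDiff {n : ℕ} (i : Fin (n - 1)) (f : Pol n) : Pol n :=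
  (dvd_sub_swapVars i f).choose

/-- `∂_i f` is the only polynomial whose product with `x_i - x_{i+1}` is `f - s_i f`. -/
theorem divDiff_eq_iff {n : ℕ} (i : Fin (n - 1)) (f g : Pol n) :
    divDiff i f = g ↔
      f - swapVars i f = (MvPolynomial.X (lo i) - MvPolynomial.X (hi i)) * g := by
  have hs := (dvd_sub_swapVars i f).choose_spec
  have h0 : (MvPolynomial.X (lo i) - MvPolynomial.X (hi i) : Pol n) ≠ 0 := by
    rw [sub_ne_zero]
    intro h
    have := MvPolynomial.X_injective h
    simp [lo, hi] at this
  constructor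
  · rintro rfl; exact hs
  · intro h
    exact mul_left_cancel₀ h0 (hs.symm.trans h)

/-- `π_i f = ∂_i (x_i f)`. -/
noncomputable def isobaric {n : ℕ} (i : Fin (n - 1)) (f : Pol n) : Pol n :=
  divDiff i (MvPolynomial.X (lo i) * f)

/-- `τ_i f = π_i ((1 + β x_{i+1}) f)`. -/
noncomputable def tau {n : ℕ} (i : Fin (n - 1)) (f : Pol n) : Pol n :=
  isobaric i ((1 + beta n * MvPolynomial.X (hi i)) * f)

/-- `\hat τ_i = τ_i - 1`. -/
noncomputable def tauHat {n : ℕ} (i : Fin (n - 1)) (f : Pol n) : Pol n :=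
  tau i f - f

/-- The composite operator `T_{a₁} ∘ ⋯ ∘ T_{aₖ}` of a word `a₁ ⋯ aₖ`. -/
def wordOp {n : ℕ} (T : Fin (n - 1) → Pol n → Pol n) (a : List (Fin (n - 1))) (f : Pol n) : Pol n :=
  a.foldr T f

/-- The monomial `x^λ`. -/
noncomputable def xPow {n : ℕ} (l : Fin n → ℕ) : Pol n := ∏ i, MvPolynomial.X i ^ l i

/-- The Lascoux polynomial `Ω_γ = τ_{w(γ)} x^{λ(γ)}`, where `τ_{w(γ)}` is computed from the
reduced word `a` of `w(γ)`. -/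
noncomputable def lascouxPolynomial {n : ℕ} (γ : Fin n → ℕ) (a : ReducedWord (compPerm γ)) :
    Pol n :=
  wordOp tau a.1 (xPow (sorted γ))

/-- The Lascoux atom `\hat τ_{w(γ)} x^{λ(γ)}`, where `\hat τ_{w(γ)}` is computed from the
reduced word `a` of `w(γ)`. -/
noncomputable def lascouxAtom {n : ℕ} (γ : Fin n → ℕ) (a : ReducedWord (compPerm γ)) : Pol n :=
  wordOp tauHat a.1 (xPow (sorted γ))

end Lascoux

namespace Lascoux

open MvPolynomial

variable {n : ℕ}

/-! ### Words and length -/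

/-! The operators $\hat\tau_i$ satisfy the relations of the 0-Hecke algebra: commutation, braid, and
$\hat\tau_i^2=-\hat\tau_i$ (`tauHat_comm`, `tauHat_braid`, `tauHat_tauHat`). By Matsumoto's theorem
$\hat\tau_v$ therefore depends only on $v$. Since $\tau_i=1+\hat\tau_i$, induction along a reduced
word of $w$ gives the operator identity $\tau_w=\sum_{v\le w}\hat\tau_v$ (`wordOp_tau_eq_sum`). In
the inductive step $w=s_iu>u$, the operator $\tau_i$ kills $\hat\tau_v$ when $s_iv<v$ and sends it
to $\hat\tau_v+\hat\tau_{s_iv}$ when $s_iv>v$. By the lifting property, the elements below $s_iu$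
are exactly the pairs $v,s_iv$ with $v\le u$ and $v<s_iv$.

Now apply both sides to $x^\lambda$ with $\lambda=\lambda(\delta)$. If $v$ has an inversion between
positions carrying equal parts of $\lambda$, some reduced word of $v$ ends in an $s_i$ fixing
$x^\lambda$, and $\hat\tau_i x^\lambda=0$ (`tauHatPerm_eq_zero`). The remaining $v$ are precisely
the $w(\gamma)$ for the rearrangements $\gamma$ of $\lambda$ (`compPerm_eq_sort`,
`sorted_comp_inv`), and their terms are the atoms. -/

theorem wordProd_cons (i : Fin (n - 1)) (a : List (Fin (n - 1))) :
    wordProd (i :: a) = simple i * wordProd a := by simp [wordProd]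

theorem wordProd_append (a b : List (Fin (n - 1))) :
    wordProd (a ++ b) = wordProd a * wordProd b := by simp [wordProd]

theorem simple_mul_self (i : Fin (n - 1)) : simple i * simple i = 1 := Equiv.swap_mul_self _ _

theorem simple_mul_cancel (i : Fin (n - 1)) (w : Equiv.Perm (Fin n)) :
    simple i * (simple i * w) = w := by rw [← mul_assoc, simple_mul_self, one_mul]

theorem lo_lt_hi (i : Fin (n - 1)) : lo i < hi i := by simp [lo, hi, Fin.lt_def]

theorem permLength_wordProd_le (a : List (Fin (n - 1))) : permLength (wordProd a) ≤ a.length :=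
  Nat.sInf_le ⟨a, rfl, rfl⟩

theorem exists_reduced (w : Equiv.Perm (Fin n)) :
    ∃ a : List (Fin (n - 1)), wordProd a = w ∧ a.length = permLength w := by
  obtain ⟨a⟩ := nonempty_reducedWord w
  exact ⟨a.1, a.2⟩

theorem permLength_one : permLength (1 : Equiv.Perm (Fin n)) = 0 :=
  Nat.le_zero.1 (permLength_wordProd_le [])

theorem permLength_simple_mul_le (i : Fin (n - 1)) (w : Equiv.Perm (Fin n)) :
    permLength (simple i * w) ≤ permLength w + 1 := by
  obtain ⟨a, rfl, ha⟩ := exists_reduced w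
  rw [← ha, ← wordProd_cons]
  exact permLength_wordProd_le _

theorem permLength_le_simple_mul (i : Fin (n - 1)) (w : Equiv.Perm (Fin n)) :
    permLength w ≤ permLength (simple i * w) + 1 := by
  simpa [simple_mul_cancel] using permLength_simple_mul_le i (simple i * w)

/-- An adjacent transposition reverses the order of no pair other than the one it exchanges. Both
the exchange property and the lifting property rest on this. -/
theorem eq_lo_hi_of_simple_lt {i : Fin (n - 1)} {p q : Fin n} (h : p < q)
    (h' : simple i q < simple i p) : p = lo i ∧ q = hi i := by
  simp only [simple, Equiv.swap_apply_def, lo, hi, Fin.ext_iff, Fin.lt_def] at *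
  split_ifs at h' <;> simp_all <;> omega

/-- The strong exchange property. -/
theorem exists_word_mul_swap (a : List (Fin (n - 1))) {x y : Fin n} (hxy : x < y)
    (h : wordProd a y < wordProd a x) :
    ∃ b : List (Fin (n - 1)), wordProd b = wordProd a * Equiv.swap x y ∧ b.length + 1 = a.length := by
  induction a with
  | nil => exact absurd h (by simpa [wordProd] using hxy.le)
  | cons i a ih =>
    rw [wordProd_cons] at h
    rcases lt_or_ge (wordProd a y) (wordProd a x) with h1 | h1
    · obtain ⟨b, hb, hl⟩ := ih h1
      exact ⟨i :: b, by rw [wordProd_cons, wordProd_cons, hb, mul_assoc], by simp [hl]⟩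
    · have h2 : wordProd a x < wordProd a y :=
        lt_of_le_of_ne h1 fun e => hxy.ne ((wordProd a).injective e)
      -- The first letter itself creates the inversion, so the tail sends `x`, `y` to `lo i`, `hi
      -- i`, and deleting that letter has the effect of the swap.
      obtain ⟨e1, e2⟩ := eq_lo_hi_of_simple_lt h2 h
      refine ⟨a, ?_, rfl⟩
      rw [wordProd_cons, mul_assoc, Equiv.mul_swap_eq_swap_mul, e1, e2]
      exact (simple_mul_cancel i _).symm

theorem permLength_mul_swap_lt {w : Equiv.Perm (Fin n)} {x y : Fin n} (hxy : x < y)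
    (h : w y < w x) : permLength (w * Equiv.swap x y) < permLength w := by
  obtain ⟨a, rfl, ha⟩ := exists_reduced w
  obtain ⟨b, hb, hl⟩ := exists_word_mul_swap a hxy h
  rw [← hb]
  have := permLength_wordProd_le b
  omega

theorem permLength_lt_mul_swap {w : Equiv.Perm (Fin n)} {x y : Fin n} (hxy : x < y)
    (h : w x < w y) : permLength w < permLength (w * Equiv.swap x y) := by
  have := permLength_mul_swap_lt (w := w * Equiv.swap x y) hxy (by simpa using h)
  simpa [mul_assoc] using this

theorem permLength_mul_swap_lt_iff {w : Equiv.Perm (Fin n)} {x y : Fin n} (hxy : x < y) :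
    permLength (w * Equiv.swap x y) < permLength w ↔ w y < w x := by
  refine ⟨fun h => ?_, permLength_mul_swap_lt hxy⟩
  by_contra h'
  exact h.not_gt (permLength_lt_mul_swap hxy
    (lt_of_le_of_ne (not_lt.1 h') fun e => hxy.ne (w.injective e)))

theorem permLength_lt_mul_swap_iff {w : Equiv.Perm (Fin n)} {x y : Fin n} (hxy : x < y) :
    permLength w < permLength (w * Equiv.swap x y) ↔ w x < w y := by
  refine ⟨fun h => ?_, permLength_lt_mul_swap hxy⟩
  by_contra h'
  exact h.not_gt (permLength_mul_swap_lt hxy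
    (lt_of_le_of_ne (not_lt.1 h') fun e => hxy.ne (w.injective e).symm))

theorem simple_mul_eq_mul_swap (i : Fin (n - 1)) (w : Equiv.Perm (Fin n)) :
    simple i * w = w * Equiv.swap (w⁻¹ (lo i)) (w⁻¹ (hi i)) := by
  rw [Equiv.mul_swap_eq_swap_mul]; simp [simple]

/-- Left multiplication by $s_i$ is right multiplication by the transposition of the positions
holding the values $i,i+1$, so the inversion criterion applies. -/
theorem permLength_simple_mul_lt_iff {i : Fin (n - 1)} {w : Equiv.Perm (Fin n)} :
    permLength (simple i * w) < permLength w ↔ w⁻¹ (hi i) < w⁻¹ (lo i) := by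
  rw [simple_mul_eq_mul_swap]
  rcases lt_trichotomy (w⁻¹ (lo i)) (w⁻¹ (hi i)) with h | h | h
  · rw [permLength_mul_swap_lt_iff h]
    exact iff_of_false (by simpa using (lo_lt_hi i).le) h.not_gt
  · exact absurd (w⁻¹.injective h) (lo_lt_hi i).ne
  · rw [Equiv.swap_comm, permLength_mul_swap_lt_iff h]
    exact iff_of_true (by simpa using lo_lt_hi i) h

theorem permLength_simple_mul_lt_or (i : Fin (n - 1)) (w : Equiv.Perm (Fin n)) :
    permLength (simple i * w) < permLength w ∨ permLength w < permLength (simple i * w) := by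
  have h := permLength_simple_mul_lt_iff (i := i) (w := simple i * w)
  rw [simple_mul_cancel] at h
  rcases lt_trichotomy (w⁻¹ (lo i)) (w⁻¹ (hi i)) with h1 | h1 | h1
  · right; rw [h]; simpa [simple] using h1
  · exact absurd (w⁻¹.injective h1) (lo_lt_hi i).ne
  · left; exact permLength_simple_mul_lt_iff.2 h1

theorem permLength_eq_of_simple_mul_lt {i : Fin (n - 1)} {w : Equiv.Perm (Fin n)}
    (h : permLength (simple i * w) < permLength w) :
    permLength w = permLength (simple i * w) + 1 := by
  have := permLength_le_simple_mul i w
  omega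

theorem permLength_eq_of_lt_simple_mul {i : Fin (n - 1)} {w : Equiv.Perm (Fin n)}
    (h : permLength w < permLength (simple i * w)) :
    permLength (simple i * w) = permLength w + 1 := by
  have := permLength_simple_mul_le i w
  omega

/-! ### Reduced words -/

/-- The word `a` is reduced. -/
def IsReducedWord (a : List (Fin (n - 1))) : Prop := a.length = permLength (wordProd a)

theorem IsReducedWord.tail {i : Fin (n - 1)} {a : List (Fin (n - 1))}
    (h : IsReducedWord (i :: a)) : IsReducedWord a := by
  have h1 := permLength_simple_mul_le i (wordProd a)
  have h2 := permLength_wordProd_le a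
  simp only [IsReducedWord, List.length_cons, wordProd_cons] at *
  omega

theorem IsReducedWord.permLength_lt {i : Fin (n - 1)} {a : List (Fin (n - 1))}
    (h : IsReducedWord (i :: a)) : permLength (wordProd a) < permLength (wordProd (i :: a)) := by
  have h1 := h.tail
  simp only [IsReducedWord, List.length_cons] at *
  omega

theorem simple_apply_of_ne {i : Fin (n - 1)} {k : Fin n} (h1 : k ≠ lo i) (h2 : k ≠ hi i) :
    simple i k = k := Equiv.swap_apply_of_ne_of_ne h1 h2

theorem simple_mul_simple (i j : Fin (n - 1)) :
    simple i * simple j = Equiv.swap (simple i (lo j)) (simple i (hi j)) * simple i :=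
  Equiv.mul_swap_eq_swap_mul _ _ _

theorem simple_comm {i j : Fin (n - 1)} (h : hi i < lo j) :
    simple i * simple j = simple j * simple i := by
  have hi' : lo i < hi i := lo_lt_hi i
  have hj : lo j < hi j := lo_lt_hi j
  rw [simple_mul_simple, simple_apply_of_ne (hi'.trans h).ne' h.ne',
    simple_apply_of_ne (hi'.trans (h.trans hj)).ne' (h.trans hj).ne']
  rfl

theorem simple_braid {i j : Fin (n - 1)} (h : hi i = lo j) :
    simple i * (simple j * simple i) = simple j * (simple i * simple j) := by
  have hi' : lo i < hi i := lo_lt_hi i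
  have hj : hi i < hi j := h ▸ lo_lt_hi j
  have h1 : simple i (lo j) = lo i := h ▸ Equiv.swap_apply_right _ _
  have h2 : simple j (hi i) = hi j := h ▸ Equiv.swap_apply_left _ _
  rw [← mul_assoc, ← mul_assoc, simple_mul_simple, simple_mul_simple j i, h1, h2,
    simple_apply_of_ne (hi'.trans hj).ne' hj.ne',
    simple_apply_of_ne (h ▸ hi'.ne) (hi'.trans hj).ne, mul_assoc, mul_assoc, simple_mul_self,
    simple_mul_self]

theorem wordOp_cons (T : Fin (n - 1) → Pol n → Pol n) (i : Fin (n - 1)) (a : List (Fin (n - 1)))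
    (f : Pol n) : wordOp T (i :: a) f = T i (wordOp T a f) := rfl

theorem wordOp_append (T : Fin (n - 1) → Pol n → Pol n) (a b : List (Fin (n - 1)))
    (f : Pol n) : wordOp T (a ++ b) f = wordOp T a (wordOp T b f) := by
  simp [wordOp]

/-- Removing $s_i$ on the left does not move the values $j,j+1$, so $j$ remains a left descent and
can be removed next. -/
theorem exists_common_word_of_lt {i j : Fin (n - 1)} (hij : hi i < lo j) {w : Equiv.Perm (Fin n)}
    (h1 : permLength (simple i * w) < permLength w)
    (h2 : permLength (simple j * w) < permLength w) :
    ∃ c, wordProd (i :: j :: c) = w ∧ IsReducedWord (i :: j :: c) := by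
  obtain ⟨c, hc, hl⟩ := exists_reduced (simple j * (simple i * w))
  have e : wordProd (i :: j :: c) = w := by
    rw [wordProd_cons, wordProd_cons, hc, simple_mul_cancel, simple_mul_cancel]
  refine ⟨c, e, ?_⟩
  have h3 : permLength (simple j * (simple i * w)) < permLength (simple i * w) := by
    rw [permLength_simple_mul_lt_iff] at h2 ⊢
    have hj : lo j < hi j := lo_lt_hi j
    have hi' : lo i < hi i := lo_lt_hi i
    rw [mul_inv_rev, Equiv.Perm.mul_apply, Equiv.Perm.mul_apply, simple, Equiv.swap_inv,
      Equiv.swap_apply_of_ne_of_ne (hi'.trans (hij.trans hj)).ne' (hij.trans hj).ne',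
      Equiv.swap_apply_of_ne_of_ne (hi'.trans hij).ne' hij.ne']
    exact h2
  have := permLength_eq_of_simple_mul_lt h1
  have := permLength_eq_of_simple_mul_lt h3
  rw [IsReducedWord, e, List.length_cons, List.length_cons, hl]
  omega

/-- The two descents make $w^{-1}$ decreasing on three consecutive values, so all of $s_is_js_i$ can
be stripped off, one unit of length at a time. -/
theorem exists_common_word_of_eq {i j : Fin (n - 1)} (hij : hi i = lo j) {w : Equiv.Perm (Fin n)}
    (h1 : permLength (simple i * w) < permLength w)
    (h2 : permLength (simple j * w) < permLength w) :
    ∃ c, wordProd (i :: j :: i :: c) = w ∧ IsReducedWord (i :: j :: i :: c) := by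
  obtain ⟨c, hc, hl⟩ := exists_reduced (simple i * (simple j * (simple i * w)))
  have e : wordProd (i :: j :: i :: c) = w := by
    rw [wordProd_cons, wordProd_cons, wordProd_cons, hc, simple_mul_cancel, simple_mul_cancel,
      simple_mul_cancel]
  refine ⟨c, e, ?_⟩
  have hi' : lo i < hi i := lo_lt_hi i
  have hj : hi i < hi j := hij ▸ lo_lt_hi j
  have k1 := permLength_simple_mul_lt_iff.1 h1
  have k2 := permLength_simple_mul_lt_iff.1 h2
  have a1 : simple i (lo i) = hi i := Equiv.swap_apply_left _ _
  have a2 : simple i (hi i) = lo i := Equiv.swap_apply_right _ _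
  have a3 : simple i (hi j) = hi j :=
    Equiv.swap_apply_of_ne_of_ne (hi'.trans hj).ne' hj.ne'
  have b1 : simple j (lo i) = lo i :=
    Equiv.swap_apply_of_ne_of_ne (hij ▸ hi'.ne) (hi'.trans hj).ne
  have b2 : simple j (hi i) = hi j := hij ▸ Equiv.swap_apply_left _ _
  have inv : ∀ k : Fin (n - 1), (simple k)⁻¹ = simple k := fun k => Equiv.swap_inv _ _
  have h3 : permLength (simple j * (simple i * w)) < permLength (simple i * w) := by
    rw [permLength_simple_mul_lt_iff, ← hij]
    simp only [mul_inv_rev, Equiv.Perm.mul_apply, inv, a2, a3]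
    exact k2.trans (hij ▸ k1)
  have h4 : permLength (simple i * (simple j * (simple i * w))) <
      permLength (simple j * (simple i * w)) := by
    rw [permLength_simple_mul_lt_iff]
    simp only [mul_inv_rev, Equiv.Perm.mul_apply, inv, a1, a3, b1, b2]
    exact hij ▸ k2
  have := permLength_eq_of_simple_mul_lt h1
  have := permLength_eq_of_simple_mul_lt h3
  have := permLength_eq_of_simple_mul_lt h4
  rw [IsReducedWord, e, List.length_cons, List.length_cons, List.length_cons, hl]
  omega

/-- Matsumoto's theorem: operators that satisfy the braid relations compose to the same operator
along all reduced words of a permutation. -/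
theorem wordOp_eq_of_isReducedWord {T : Fin (n - 1) → Pol n → Pol n}
    (hcomm : ∀ i j, hi i < lo j → ∀ f, T i (T j f) = T j (T i f))
    (hbraid : ∀ i j, hi i = lo j → ∀ f, T i (T j (T i f)) = T j (T i (T j f)))
    {a b : List (Fin (n - 1))} (ha : IsReducedWord a) (hb : IsReducedWord b)
    (hab : wordProd a = wordProd b) (f : Pol n) : wordOp T a f = wordOp T b f := by
  induction hk : a.length generalizing a b with
  | zero =>
    have : b.length = 0 := by rw [← hk, ha, hb, hab]
    rw [List.length_eq_zero_iff.1 hk, List.length_eq_zero_iff.1 this]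
  | succ k ih =>
    have hlen : b.length = a.length := by rw [ha, hb, hab]
    obtain ⟨i, a, rfl⟩ := List.exists_cons_of_length_eq_add_one hk
    obtain ⟨j, b, rfl⟩ := List.exists_cons_of_length_eq_add_one (hlen.trans hk)
    have hka : a.length = k := by simpa using hk
    have hkb : b.length = k := by simpa [hka] using hlen
    have cancel : ∀ {l : Fin (n - 1)} {c d : List (Fin (n - 1))},
        wordProd (l :: c) = wordProd (l :: d) → wordProd c = wordProd d := by
      intro l c d h
      rw [wordProd_cons, wordProd_cons] at h
      exact mul_left_cancel h
    -- Words with different first letters are compared through reduced words that begin with the two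
    -- sides of a commutation or braid relation and share a tail `c`. The induction hypothesis is
    -- used only after a common first letter is removed.
    have main : ∀ {i j : Fin (n - 1)} {a b : List (Fin (n - 1))}, i < j →
        IsReducedWord (i :: a) → IsReducedWord (j :: b) →
        wordProd (i :: a) = wordProd (j :: b) → a.length = k → b.length = k →
        wordOp T (i :: a) f = wordOp T (j :: b) f := by
      intro i j a b hij ha hb hab hka hkb
      have h1 : permLength (simple i * wordProd (i :: a)) < permLength (wordProd (i :: a)) := by
        rw [wordProd_cons, simple_mul_cancel, ← wordProd_cons]; exact ha.permLength_lt
      have h2 : permLength (simple j * wordProd (i :: a)) < permLength (wordProd (i :: a)) := by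
        rw [hab, wordProd_cons, simple_mul_cancel, ← wordProd_cons]; exact hb.permLength_lt
      have hlt : hi i ≤ lo j := by simpa [hi, lo, Fin.le_def] using hij
      rcases hlt.lt_or_eq with hlt | heq
      · obtain ⟨c, hc, hr⟩ := exists_common_word_of_lt hlt h1 h2
        have hc' : wordProd (j :: i :: c) = wordProd (j :: b) := by
          rw [← hab, ← hc]
          simp only [wordProd_cons, ← mul_assoc, simple_comm hlt]
        have hr' : IsReducedWord (j :: i :: c) := by
          rw [IsReducedWord, hc', ← hab, ← hc]; exact hr
        rw [wordOp_cons, wordOp_cons, ih ha.tail hr.tail (cancel hc.symm) hka,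
          ih hb.tail hr'.tail (cancel hc'.symm) hkb, wordOp_cons, wordOp_cons, hcomm _ _ hlt]
      · obtain ⟨c, hc, hr⟩ := exists_common_word_of_eq heq h1 h2
        have hc' : wordProd (j :: i :: j :: c) = wordProd (j :: b) := by
          rw [← hab, ← hc]
          simp only [wordProd_cons]
          rw [← mul_assoc, ← mul_assoc, ← mul_assoc, ← mul_assoc, mul_assoc (simple j),
            mul_assoc (simple i), simple_braid heq]
        have hr' : IsReducedWord (j :: i :: j :: c) := by
          rw [IsReducedWord, hc', ← hab, ← hc]; exact hr
        rw [wordOp_cons, wordOp_cons, ih ha.tail hr.tail (cancel hc.symm) hka,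
          ih hb.tail hr'.tail (cancel hc'.symm) hkb]
        simp only [wordOp_cons, hbraid _ _ heq]
    rcases lt_trichotomy i j with h | rfl | h
    · exact main h ha hb hab hka hkb
    · rw [wordOp_cons, wordOp_cons, ih ha.tail hb.tail (cancel hab) hka]
    · exact (main h hb ha hab.symm hkb hka).symm

/-! ### The operators `τ_i` and `\hat τ_i` -/

theorem X_lo_sub_X_hi_ne_zero (i : Fin (n - 1)) : (X (lo i) - X (hi i) : Pol n) ≠ 0 := by
  rw [sub_ne_zero]
  exact fun h => (lo_lt_hi i).ne (X_injective h)

theorem X_sub_X_mul_divDiff (i : Fin (n - 1)) (f : Pol n) :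
    (X (lo i) - X (hi i)) * divDiff i f = f - swapVars i f :=
  ((divDiff_eq_iff i f _).1 rfl).symm

theorem swapVars_add (i : Fin (n - 1)) (f g : Pol n) :
    swapVars i (f + g) = swapVars i f + swapVars i g := map_add _ _ _

theorem swapVars_sub (i : Fin (n - 1)) (f g : Pol n) :
    swapVars i (f - g) = swapVars i f - swapVars i g := map_sub _ _ _

theorem swapVars_mul (i : Fin (n - 1)) (f g : Pol n) :
    swapVars i (f * g) = swapVars i f * swapVars i g := map_mul _ _ _

theorem swapVars_one (i : Fin (n - 1)) : swapVars i (1 : Pol n) = 1 := map_one _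

theorem swapVars_beta (i : Fin (n - 1)) : swapVars i (beta n) = beta n := rename_C _ _

theorem swapVars_X (i : Fin (n - 1)) (k : Fin n) : swapVars i (X k : Pol n) = X (simple i k) :=
  rename_X _ _

theorem swapVars_X_lo (i : Fin (n - 1)) : swapVars i (X (lo i) : Pol n) = X (hi i) := by
  rw [swapVars_X, simple, Equiv.swap_apply_left]

theorem swapVars_X_hi (i : Fin (n - 1)) : swapVars i (X (hi i) : Pol n) = X (lo i) := by
  rw [swapVars_X, simple, Equiv.swap_apply_right]

theorem swapVars_swapVars (i j : Fin (n - 1)) (f : Pol n) :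
    swapVars i (swapVars j f) = rename (simple i * simple j) f := by
  rw [swapVars, swapVars, rename_rename]; rfl

theorem swapVars_self (i : Fin (n - 1)) (f : Pol n) : swapVars i (swapVars i f) = f := by
  rw [swapVars_swapVars, simple_mul_self]; exact rename_id_apply f

/-- The denominator-free form of $\hat\tau_i$. The operator relations below become ring identities
among instances of this formula and their images under the $s_j$. -/
theorem X_sub_X_mul_tauHat (i : Fin (n - 1)) (f : Pol n) :
    (X (lo i) - X (hi i)) * tauHat i f =
      X (hi i) * (1 + beta n * X (lo i)) * (f - swapVars i f) := by
  rw [tauHat, mul_sub, tau, isobaric, X_sub_X_mul_divDiff]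
  simp only [swapVars_mul, swapVars_add, swapVars_one, swapVars_beta, swapVars_X_lo, swapVars_X_hi]
  ring

theorem tauHat_eq_iff (i : Fin (n - 1)) (f g : Pol n) :
    tauHat i f = g ↔ (X (lo i) - X (hi i)) * g =
      X (hi i) * (1 + beta n * X (lo i)) * (f - swapVars i f) := by
  rw [← X_sub_X_mul_tauHat, mul_right_inj' (X_lo_sub_X_hi_ne_zero i), eq_comm]

theorem tauHat_add (i : Fin (n - 1)) (f g : Pol n) :
    tauHat i (f + g) = tauHat i f + tauHat i g := by
  rw [tauHat_eq_iff, mul_add, X_sub_X_mul_tauHat, X_sub_X_mul_tauHat, swapVars_add]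
  ring

theorem tauHat_sum {ι : Type*} (s : Finset ι) (i : Fin (n - 1)) (f : ι → Pol n) :
    tauHat i (∑ k ∈ s, f k) = ∑ k ∈ s, tauHat i (f k) :=
  map_sum (AddMonoidHom.mk' (tauHat i) (tauHat_add i)) f s

theorem tauHat_eq_zero {i : Fin (n - 1)} {f : Pol n} (h : swapVars i f = f) : tauHat i f = 0 := by
  rw [tauHat_eq_iff, h]; ring

theorem tau_eq (i : Fin (n - 1)) (f : Pol n) : tau i f = f + tauHat i f := by
  rw [tauHat]; ring

theorem swapVars_tau (i : Fin (n - 1)) (f : Pol n) : swapVars i (tau i f) = tau i f := by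
  apply mul_left_cancel₀ (X_lo_sub_X_hi_ne_zero i)
  have h := X_sub_X_mul_tauHat i f
  have h' := congrArg (swapVars i) h
  simp only [swapVars_mul, swapVars_sub, swapVars_add, swapVars_one, swapVars_beta,
    swapVars_X_lo, swapVars_X_hi, swapVars_self] at h'
  rw [tau_eq, swapVars_add]
  linear_combination -h' - h

/-- The image of $\tau_i=1+\hat\tau_i$ is $s_i$-symmetric, hence killed by $\hat\tau_i$. -/
theorem tauHat_tauHat (i : Fin (n - 1)) (f : Pol n) : tauHat i (tauHat i f) = -tauHat i f := by
  have h := tauHat_eq_zero (swapVars_tau i f)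
  rw [tau_eq, tauHat_add] at h
  linear_combination h

theorem tauHat_comm {i j : Fin (n - 1)} (h : hi i < lo j) (f : Pol n) :
    tauHat i (tauHat j f) = tauHat j (tauHat i f) := by
  apply mul_left_cancel₀ (X_lo_sub_X_hi_ne_zero i)
  apply mul_left_cancel₀ (X_lo_sub_X_hi_ne_zero j)
  have hi' : lo i < hi i := lo_lt_hi i
  have hj : lo j < hi j := lo_lt_hi j
  have a1 : swapVars i (X (lo j) : Pol n) = X (lo j) := by
    rw [swapVars_X, simple, Equiv.swap_apply_of_ne_of_ne (hi'.trans h).ne' h.ne']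
  have a2 : swapVars i (X (hi j) : Pol n) = X (hi j) := by
    rw [swapVars_X, simple,
      Equiv.swap_apply_of_ne_of_ne (hi'.trans (h.trans hj)).ne' (h.trans hj).ne']
  have b1 : swapVars j (X (lo i) : Pol n) = X (lo i) := by
    rw [swapVars_X, simple,
      Equiv.swap_apply_of_ne_of_ne (hi'.trans h).ne (hi'.trans (h.trans hj)).ne]
  have b2 : swapVars j (X (hi i) : Pol n) = X (hi i) := by
    rw [swapVars_X, simple, Equiv.swap_apply_of_ne_of_ne h.ne (h.trans hj).ne]
  have e : swapVars i (swapVars j f) = swapVars j (swapVars i f) := by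
    rw [swapVars_swapVars, swapVars_swapVars, simple_comm h]
  have p0 := X_sub_X_mul_tauHat i f
  have q0 := X_sub_X_mul_tauHat j f
  have p1 := congrArg (swapVars j) p0
  have q1 := congrArg (swapVars i) q0
  have p2 := X_sub_X_mul_tauHat j (tauHat i f)
  have q2 := X_sub_X_mul_tauHat i (tauHat j f)
  simp only [swapVars_mul, swapVars_sub, swapVars_add, swapVars_one, swapVars_beta,
    a1, a2, b1, b2] at p1 q1
  rw [e] at q1
  generalize (X (lo i) : Pol n) = x at *
  generalize (X (hi i) : Pol n) = y at *
  generalize (X (lo j) : Pol n) = z at *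
  generalize (X (hi j) : Pol n) = t at *
  linear_combination (z - t) * q2 + y * (1 + beta n * x) * (q0 - q1)
    - (x - y) * p2 - t * (1 + beta n * z) * (p0 - p1)

theorem tauHat_braid {i j : Fin (n - 1)} (h : hi i = lo j) (f : Pol n) :
    tauHat i (tauHat j (tauHat i f)) = tauHat j (tauHat i (tauHat j f)) := by
  have hi' : lo i < hi i := lo_lt_hi i
  have hj : hi i < hi j := h ▸ lo_lt_hi j
  have a1 : swapVars i (X (hi j) : Pol n) = X (hi j) := by
    rw [swapVars_X, simple, Equiv.swap_apply_of_ne_of_ne (hi'.trans hj).ne' hj.ne']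
  have a2 := swapVars_X_lo i
  have a3 := swapVars_X_hi i
  have b1 : swapVars j (X (lo i) : Pol n) = X (lo i) := by
    rw [swapVars_X, simple, Equiv.swap_apply_of_ne_of_ne (h ▸ hi'.ne) (hi'.trans hj).ne]
  have b2 := swapVars_X_lo j
  have b3 := swapVars_X_hi j
  have e : swapVars i (swapVars j (swapVars i f)) = swapVars j (swapVars i (swapVars j f)) := by
    have := congrArg (fun p : Equiv.Perm (Fin n) => rename p f) (simple_braid h)
    rw [swapVars_swapVars j, swapVars_swapVars i j]
    rw [swapVars, swapVars, rename_rename, rename_rename]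
    exact this
  have d1 := X_lo_sub_X_hi_ne_zero i
  have d2 := X_lo_sub_X_hi_ne_zero j
  have d3 : (X (lo i) - X (hi j) : Pol n) ≠ 0 :=
    sub_ne_zero.2 fun h => (hi'.trans hj).ne (X_injective h)
  have p0 := X_sub_X_mul_tauHat i f
  have p1 := congrArg (swapVars i) p0
  have p2 := congrArg (swapVars j) p0
  have p3 := congrArg (swapVars i) p2
  have p4 := X_sub_X_mul_tauHat j (tauHat i f)
  have p5 := congrArg (swapVars i) p4
  have p6 := X_sub_X_mul_tauHat i (tauHat j (tauHat i f))
  have q0 := X_sub_X_mul_tauHat j f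
  have q1 := congrArg (swapVars j) q0
  have q2 := congrArg (swapVars i) q0
  have q3 := congrArg (swapVars j) q2
  have q4 := X_sub_X_mul_tauHat i (tauHat j f)
  have q5 := congrArg (swapVars j) q4
  have q6 := X_sub_X_mul_tauHat j (tauHat i (tauHat j f))
  rw [← h] at *
  simp only [swapVars_mul, swapVars_sub, swapVars_add, swapVars_one, swapVars_beta,
    a1, a2, a3, b1, b2, b3, swapVars_self, e] at p1 p2 p3 p5 q1 q2 q3 q5
  generalize (X (lo i) : Pol n) = x at *
  generalize (X (hi i) : Pol n) = y at *
  generalize (X (hi j) : Pol n) = z at *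
  -- The two sides have denominators $(x-y)^2(y-z)(x-z)$ and $(x-y)(y-z)^2(x-z)$, the factor $x-z$
  -- coming from conjugates of $x-y$ and $y-z$. Their least common multiple clears both, and the
  -- `p`'s and `q`'s then expand the left and right sides in the permuted copies of `f`.
  apply mul_left_cancel₀ (mul_ne_zero (mul_ne_zero (mul_ne_zero d1 d1) (mul_ne_zero d2 d2)) d3)
  linear_combination
    (y - z) * ((x - y) * (y - z) * (x - z) * p6
      + y * (1 + beta n * x) * ((x - z) * (x - y) * p4 - (x - y) * (y - z) * p5
      + (x - z) * z * (1 + beta n * y) * p0 - (x - y) * z * (1 + beta n * y) * p2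
      + (y - z) * z * (1 + beta n * x) * p1 + (x - y) * z * (1 + beta n * x) * p3))
    - (x - y) * ((y - z) * (x - y) * (x - z) * q6
      + z * (1 + beta n * y) * ((x - z) * (y - z) * q4 - (x - y) * (y - z) * q5
      + (x - z) * y * (1 + beta n * x) * q0 - (y - z) * y * (1 + beta n * x) * q2
      + (x - y) * z * (1 + beta n * x) * q1 + (y - z) * z * (1 + beta n * x) * q3))

/-! ### Bruhat order -/

theorem BruhatLE.trans {u v w : Equiv.Perm (Fin n)} (h : BruhatLE u v) (h' : BruhatLE v w) :
    BruhatLE u w := Relation.ReflTransGen.trans h h'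

theorem bruhatLE_simple_mul {i : Fin (n - 1)} {w : Equiv.Perm (Fin n)}
    (h : permLength w < permLength (simple i * w)) : BruhatLE w (simple i * w) :=
  Relation.ReflTransGen.single ⟨⟨_, ⟨_, _, w⁻¹.injective.ne (lo_lt_hi i).ne, rfl⟩,
    simple_mul_eq_mul_swap i w⟩, h⟩

theorem bruhatLE_one_iff {v : Equiv.Perm (Fin n)} : BruhatLE v 1 ↔ v = 1 := by
  constructor
  · intro h
    rcases Relation.ReflTransGen.cases_tail h with h | ⟨x, -, -, hx⟩
    · exact h.symm
    · rw [permLength_one] at hx; omega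
  · rintro rfl; exact Relation.ReflTransGen.refl

/-- The shorter one of `w` and `s_i w`. -/
noncomputable def lower (i : Fin (n - 1)) (w : Equiv.Perm (Fin n)) : Equiv.Perm (Fin n) :=
  if permLength w < permLength (simple i * w) then w else simple i * w

/-- The longer one of `w` and `s_i w`. -/
noncomputable def upper (i : Fin (n - 1)) (w : Equiv.Perm (Fin n)) : Equiv.Perm (Fin n) :=
  if permLength w < permLength (simple i * w) then simple i * w else w

/-- Left multiplication by `s_i` preserves a Bruhat covering step `x < x t` unless `x t = s_i x`. -/
theorem permLength_simple_mul_lt_simple_mul_mul_swap {i : Fin (n - 1)} {x : Equiv.Perm (Fin n)}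
    {p q : Fin n} (hpq : p < q) (h : permLength x < permLength (x * Equiv.swap p q))
    (hne : simple i * x ≠ x * Equiv.swap p q) :
    permLength (simple i * x) < permLength (simple i * x * Equiv.swap p q) := by
  rw [permLength_lt_mul_swap_iff hpq] at h ⊢
  by_contra h'
  have h1 : simple i (x q) < simple i (x p) :=
    lt_of_le_of_ne (not_lt.1 h') fun e => hpq.ne' (x.injective ((simple i).injective e))
  obtain ⟨e1, e2⟩ := eq_lo_hi_of_simple_lt h h1
  apply hne
  rw [Equiv.mul_swap_eq_swap_mul, e1, e2, simple]

/-- Either $xt=s_ix$ and both elements span the same pair, or $s_i$ preserves the step. In the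
latter case $x<xt$ and $s_ix<s_ixt$ combine with the comparisons inside each pair. -/
theorem lower_upper_mono_step {i : Fin (n - 1)} {x : Equiv.Perm (Fin n)} {p q : Fin n}
    (hpq : p < q) (h : permLength x < permLength (x * Equiv.swap p q)) :
    BruhatLE (lower i x) (lower i (x * Equiv.swap p q)) ∧
      BruhatLE (upper i x) (upper i (x * Equiv.swap p q)) := by
  have hs : (Equiv.swap p q).IsSwap := ⟨p, q, hpq.ne, rfl⟩
  by_cases e : simple i * x = x * Equiv.swap p q
  · have h' : ¬ permLength (simple i * x) < permLength x := by rw [e]; exact h.not_gt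
    rw [← e, lower, lower, upper, upper, simple_mul_cancel, if_neg h', if_neg h', e, if_pos h,
      if_pos h]
    exact ⟨Relation.ReflTransGen.refl, Relation.ReflTransGen.refl⟩
  · have h1 := permLength_simple_mul_lt_simple_mul_mul_swap hpq h e
    have r0 : BruhatLE x (x * Equiv.swap p q) := Relation.ReflTransGen.single ⟨⟨_, hs, rfl⟩, h⟩
    have r1 : BruhatLE (simple i * x) (simple i * (x * Equiv.swap p q)) :=
      Relation.ReflTransGen.single ⟨⟨_, hs, (mul_assoc _ _ _).symm⟩, by rwa [← mul_assoc]⟩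
    have key : ∀ w : Equiv.Perm (Fin n), ¬ permLength w < permLength (simple i * w) →
        BruhatLE (simple i * w) w := fun w hw => by
      have := bruhatLE_simple_mul (i := i) (w := simple i * w)
        (by rw [simple_mul_cancel]; exact (permLength_simple_mul_lt_or i w).resolve_right hw)
      rwa [simple_mul_cancel] at this
    unfold lower upper
    split_ifs with c1 c2 c2
    · exact ⟨r0, r1⟩
    · exact ⟨(bruhatLE_simple_mul c1).trans r1, r1.trans (key _ c2)⟩
    · exact ⟨(key _ c1).trans r0, r0.trans (bruhatLE_simple_mul c2)⟩
    · exact ⟨r1, r0⟩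

/-- The lifting property of the Bruhat order. -/
theorem BruhatLE.lower_upper {x y : Equiv.Perm (Fin n)} (h : BruhatLE x y) (i : Fin (n - 1)) :
    BruhatLE (lower i x) (lower i y) ∧ BruhatLE (upper i x) (upper i y) := by
  induction h with
  | refl => exact ⟨Relation.ReflTransGen.refl, Relation.ReflTransGen.refl⟩
  | tail _ hyz ih =>
    obtain ⟨⟨t, ⟨p, q, hpq, rfl⟩, rfl⟩, hl⟩ := hyz
    rcases hpq.lt_or_gt with hpq | hpq
    · obtain ⟨h1, h2⟩ := lower_upper_mono_step (i := i) hpq hl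
      exact ⟨ih.1.trans h1, ih.2.trans h2⟩
    · rw [Equiv.swap_comm] at hl ⊢
      obtain ⟨h1, h2⟩ := lower_upper_mono_step (i := i) hpq hl
      exact ⟨ih.1.trans h1, ih.2.trans h2⟩

/-- The shorter elements of the pairs of $v$ and $s_iu$ are $v$ and $u$, so lifting applies. With
the next lemma this describes everything below $s_iu$ in terms of what lies below $u$. -/
theorem bruhatLE_simple_mul_iff {i : Fin (n - 1)} {v u : Equiv.Perm (Fin n)}
    (hv : permLength v < permLength (simple i * v))
    (hu : permLength u < permLength (simple i * u)) :
    BruhatLE v (simple i * u) ↔ BruhatLE v u := by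
  refine ⟨fun h => ?_, fun h => h.trans (bruhatLE_simple_mul hu)⟩
  have := (h.lower_upper i).1
  rwa [lower, if_pos hv, lower, simple_mul_cancel, if_neg hu.not_gt] at this

theorem simple_mul_bruhatLE_simple_mul_iff {i : Fin (n - 1)} {v u : Equiv.Perm (Fin n)}
    (hv : permLength v < permLength (simple i * v))
    (hu : permLength u < permLength (simple i * u)) :
    BruhatLE (simple i * v) (simple i * u) ↔ BruhatLE v u := by
  refine ⟨fun h => (bruhatLE_simple_mul_iff hv hu).1 ((bruhatLE_simple_mul hv).trans h),
    fun h => ?_⟩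
  have := (h.lower_upper i).2
  rwa [upper, if_pos hv, upper, if_pos hu] at this

/-! ### Expansion of `τ_w` -/

/-- The operator `\hat τ_w` of a permutation `w`. -/
noncomputable def tauHatPerm (w : Equiv.Perm (Fin n)) (f : Pol n) : Pol n :=
  wordOp tauHat (exists_reduced w).choose f

theorem wordOp_tauHat {a : List (Fin (n - 1))} (ha : IsReducedWord a) (f : Pol n) :
    wordOp tauHat a f = tauHatPerm (wordProd a) f := by
  obtain ⟨h1, h2⟩ := (exists_reduced (wordProd a)).choose_spec
  exact wordOp_eq_of_isReducedWord (fun _ _ h f => tauHat_comm h f)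
    (fun _ _ h f => tauHat_braid h f) ha (by rw [IsReducedWord, h1, h2]) h1.symm f

theorem tauHat_tauHatPerm {i : Fin (n - 1)} {w : Equiv.Perm (Fin n)}
    (h : permLength w < permLength (simple i * w)) (f : Pol n) :
    tauHat i (tauHatPerm w f) = tauHatPerm (simple i * w) f := by
  obtain ⟨a, rfl, ha⟩ := exists_reduced w
  rw [← wordProd_cons, ← wordOp_tauHat ha, ← wordOp_tauHat, wordOp_cons]
  rw [IsReducedWord, wordProd_cons, permLength_eq_of_lt_simple_mul h, List.length_cons, ha]

/-- Here $\hat\tau_w=\hat\tau_i\hat\tau_{s_iw}$, and $(1+\hat\tau_i)\hat\tau_i=0$. -/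
theorem tau_tauHatPerm_of_lt {i : Fin (n - 1)} {w : Equiv.Perm (Fin n)}
    (h : permLength (simple i * w) < permLength w) (f : Pol n) :
    tauHatPerm w f + tauHat i (tauHatPerm w f) = 0 := by
  have := tauHat_tauHatPerm (i := i) (w := simple i * w) (by rwa [simple_mul_cancel]) f
  rw [simple_mul_cancel] at this
  rw [← this, tauHat_tauHat]
  ring

open Classical in
-- Expanding along an arbitrary reduced word makes braid relations for $\tau_i$ itself unnecessary:
-- the right side depends only on the product.
theorem wordOp_tau_eq_sum {a : List (Fin (n - 1))} (ha : IsReducedWord a) (f : Pol n) :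
    wordOp tau a f = ∑ v with BruhatLE v (wordProd a), tauHatPerm v f := by
  induction a with
  | nil =>
    have h : (Finset.univ.filter fun v : Equiv.Perm (Fin n) => BruhatLE v (wordProd [])) = {1} := by
      ext v
      simpa [wordProd] using bruhatLE_one_iff
    rw [h, Finset.sum_singleton]
    exact wordOp_tauHat (a := []) permLength_one.symm f
  | cons i a ih =>
    have hu : permLength (wordProd a) < permLength (simple i * wordProd a) := by
      rw [← wordProd_cons]; exact ha.permLength_lt
    rw [wordOp_cons, tau_eq, ih ha.tail, tauHat_sum, ← Finset.sum_add_distrib, wordProd_cons]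
    generalize wordProd a = u at hu
    -- Both sums are split by whether $s_i$ lengthens $v$. The ascent terms $\hat\tau_v$ agree, the
    -- descent terms on the left vanish, and the terms $\hat\tau_i\hat\tau_v=\hat\tau_{s_iv}$ match
    -- the descents on the right through $v\mapsto s_iv$.
    rw [← Finset.sum_filter_add_sum_filter_not _
        (fun v => permLength v < permLength (simple i * v)),
      ← Finset.sum_filter_add_sum_filter_not
        (Finset.univ.filter fun v => BruhatLE v (simple i * u))
        (fun v => permLength v < permLength (simple i * v)), Finset.sum_add_distrib, add_assoc]
    congr 1
    · refine Finset.sum_congr ?_ fun _ _ => rfl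
      ext v
      simp only [Finset.mem_filter, Finset.mem_univ, true_and]
      exact and_congr_left fun hv => (bruhatLE_simple_mul_iff hv hu).symm
    · rw [Finset.sum_eq_zero (s := Finset.filter (fun v => ¬ _) _), add_zero]
      · refine Finset.sum_bij' (fun v _ => simple i * v) (fun v _ => simple i * v) ?_ ?_
          (fun v _ => simple_mul_cancel i v) (fun v _ => simple_mul_cancel i v) ?_
        · intro v hv
          simp only [Finset.mem_filter, Finset.mem_univ, true_and] at hv ⊢
          rw [simple_mul_bruhatLE_simple_mul_iff hv.2 hu, simple_mul_cancel]
          exact ⟨hv.1, hv.2.not_gt⟩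
        · intro v hv
          simp only [Finset.mem_filter, Finset.mem_univ, true_and] at hv ⊢
          have hl : permLength (simple i * v) < permLength (simple i * (simple i * v)) := by
            rw [simple_mul_cancel]
            exact (permLength_simple_mul_lt_or i v).resolve_right hv.2
          rw [← simple_mul_bruhatLE_simple_mul_iff hl hu, simple_mul_cancel]
          exact ⟨hv.1, by rwa [simple_mul_cancel] at hl⟩
        · intro v hv
          exact tauHat_tauHatPerm (Finset.mem_filter.1 hv).2 f
      · intro v hv
        exact tau_tauHatPerm_of_lt
          ((permLength_simple_mul_lt_or i v).resolve_right (Finset.mem_filter.1 hv).2) f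

/-! ### Weak compositions -/

theorem compPerm_mem (γ : Fin n → ℕ) (i : Fin n) : γ (compPerm γ i) = sorted γ i :=
  Function.argminOn_mem permLength (sendingPerms γ) (sendingPerms_nonempty γ) i

theorem eq_sort_iff {γ : Fin n → ℕ} {w : Equiv.Perm (Fin n)} :
    w = Tuple.sort (OrderDual.toDual ∘ γ) ↔
      Antitone (γ ∘ w) ∧ ∀ i j, i < j → γ (w i) = γ (w j) → w i < w j :=
  Tuple.eq_sort_iff

/-- If the shortest sending permutation inverted two positions with equal parts, swapping them would
give a shorter one. Hence it is the stable sort, which makes it unique. -/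
theorem compPerm_eq_sort (γ : Fin n → ℕ) :
    compPerm γ = Tuple.sort (OrderDual.toDual ∘ γ) := by
  rw [eq_sort_iff]
  have h : γ ∘ compPerm γ = sorted γ := funext (compPerm_mem γ)
  refine ⟨h ▸ sorted_antitone γ, fun i j hij e => ?_⟩
  by_contra hlt
  have hlt : compPerm γ j < compPerm γ i :=
    lt_of_le_of_ne (not_lt.1 hlt) fun e' => hij.ne' ((compPerm γ).injective e')
  refine (permLength_mul_swap_lt hij hlt).not_ge
    (Function.argminOn_le permLength (sendingPerms γ) (?_ : _ ∈ sendingPerms γ))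
  intro k
  rw [← compPerm_mem γ k, Equiv.Perm.mul_apply]
  rcases eq_or_ne k i with rfl | h1
  · rw [Equiv.swap_apply_left, e]
  · rcases eq_or_ne k j with rfl | h2
    · rw [Equiv.swap_apply_right, e]
    · rw [Equiv.swap_apply_of_ne_of_ne h1 h2]

/-- Every permutation increasing on the blocks of equal parts of $\lambda$ occurs as $w(\gamma)$,
namely for $\gamma=\lambda\circ v^{-1}$. -/
theorem sorted_comp_inv {l : Fin n → ℕ} (hl : Antitone l) {v : Equiv.Perm (Fin n)}
    (hv : ∀ i j, i < j → l i = l j → v i < v j) :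
    sorted (l ∘ ⇑v⁻¹) = l ∧ compPerm (l ∘ ⇑v⁻¹) = v := by
  have e : (l ∘ ⇑v⁻¹) ∘ ⇑v = l := by funext i; simp
  have h : v = Tuple.sort (OrderDual.toDual ∘ (l ∘ ⇑v⁻¹)) := by
    rw [eq_sort_iff, e]
    exact ⟨hl, fun i j hij hh => hv i j hij (by simpa using hh)⟩
  exact ⟨by rw [sorted, ← h, e], by rw [compPerm_eq_sort, ← h]⟩

theorem swapVars_xPow {l : Fin n → ℕ} {i : Fin (n - 1)} (h : l (lo i) = l (hi i)) :
    swapVars i (xPow l) = xPow l := by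
  rw [swapVars, xPow, map_prod]
  refine Fintype.prod_equiv (simple i) _ _ fun k => ?_
  rw [map_pow, rename_X]
  congr 1
  rcases eq_or_ne k (lo i) with rfl | h1
  · rw [simple, Equiv.swap_apply_left, h]
  · rcases eq_or_ne k (hi i) with rfl | h2
    · rw [simple, Equiv.swap_apply_right, h]
    · rw [simple_apply_of_ne h1 h2]

theorem wordOp_tauHat_zero (a : List (Fin (n - 1))) : wordOp tauHat a (0 : Pol n) = 0 := by
  induction a with
  | nil => rfl
  | cons i a ih => rw [wordOp_cons, ih]; exact tauHat_eq_zero (map_zero _)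

/-- A right descent at $i$ gives a reduced word ending in $i$, so $\hat\tau_i$ is the first operator
to act on $f$. -/
theorem tauHatPerm_eq_zero {v : Equiv.Perm (Fin n)} {i : Fin (n - 1)} {f : Pol n}
    (hv : v (hi i) < v (lo i)) (hf : swapVars i f = f) : tauHatPerm v f = 0 := by
  obtain ⟨a, ha, hl⟩ := exists_reduced (v * simple i)
  have h1 : wordProd (a ++ [i]) = v := by
    rw [wordProd_append, ha, wordProd_cons, mul_assoc, ← mul_assoc (simple i), simple_mul_self]
    simp [wordProd]
  have h2 : permLength (v * simple i) < permLength v := permLength_mul_swap_lt (lo_lt_hi i) hv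
  have h3 : IsReducedWord (a ++ [i]) := by
    have := permLength_wordProd_le (a ++ [i])
    rw [IsReducedWord]
    rw [h1, List.length_append, List.length_singleton] at *
    omega
  rw [← h1, ← wordOp_tauHat h3, wordOp_append, wordOp_cons]
  change wordOp tauHat a (tauHat i f) = 0
  rw [tauHat_eq_zero hf, wordOp_tauHat_zero]

/-- Monotonicity makes $\lambda$ constant between the two positions. Without an adjacent inversion
there, $v$ would increase from one to the other. -/
theorem exists_adjacent_inversion {l : Fin n → ℕ} (hl : Antitone l) {v : Equiv.Perm (Fin n)}
    {p q : Fin n} (hpq : p < q) (hlpq : l p = l q) (hv : v q < v p) :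
    ∃ i : Fin (n - 1), l (lo i) = l (hi i) ∧ v (hi i) < v (lo i) := by
  by_contra! hcon
  obtain ⟨p, hp⟩ := p
  obtain ⟨q, hq⟩ := q
  refine hv.not_ge ?_
  have hpq' : p ≤ q := hpq.le
  clear hv hpq
  induction q, hpq' using Nat.le_induction with
  | base => exact le_rfl
  | succ q hle ih =>
    have hq' : q < n := by omega
    have e1 : l ⟨q, hq'⟩ ≤ l ⟨p, hp⟩ := hl hle
    have e2 : l ⟨q + 1, hq⟩ ≤ l ⟨q, hq'⟩ := hl (Nat.le_succ q)
    refine (ih hq' (by omega)).trans (hcon ⟨q, by omega⟩ ?_)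
    change l ⟨q, hq'⟩ = l ⟨q + 1, hq⟩
    omega

end Lascoux

open Lascoux in
theorem mainTheorem9 (n : ℕ) (δ : Fin n → ℕ)
    (a : Lascoux.ReducedWord (Lascoux.compPerm δ))
    (b : ∀ γ : Fin n → ℕ, Lascoux.ReducedWord (Lascoux.compPerm γ)) :
    Lascoux.lascouxPolynomial δ a =
      ∑ γ ∈ Lascoux.compsBelow δ, Lascoux.lascouxAtom γ (b γ) := by
  classical
  have hred : ∀ {w : Equiv.Perm (Fin n)} (c : ReducedWord w), IsReducedWord c.1 := fun c => by
    rw [IsReducedWord, c.2.1, c.2.2]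
  have hatom : ∀ γ ∈ compsBelow δ,
      lascouxAtom γ (b γ) = tauHatPerm (compPerm γ) (xPow (sorted δ)) := fun γ hγ => by
    have h : CompLE γ δ := (finite_compLE δ).mem_toFinset.1 hγ
    rw [lascouxAtom, wordOp_tauHat (hred _), (b γ).2.1, h.1]
  rw [lascouxPolynomial, wordOp_tau_eq_sum (hred a), Finset.sum_congr rfl hatom, a.2.1]
  symm
  -- The atoms are matched with permutations by $\gamma\mapsto w(\gamma)$, injective once
  -- $\lambda(\gamma)=\lambda(\delta)$ is fixed. It remains to see that permutations outside the
  -- image contribute zero.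
  refine Finset.sum_of_injOn compPerm ?_ ?_ ?_ fun _ _ => rfl
  · intro γ hγ γ' hγ' e
    have h : CompLE γ δ := (finite_compLE δ).mem_toFinset.1 hγ
    have h' : CompLE γ' δ := (finite_compLE δ).mem_toFinset.1 hγ'
    funext k
    obtain ⟨j, rfl⟩ := (compPerm γ).surjective k
    rw [compPerm_mem γ, e, compPerm_mem γ', h.1, h'.1]
  · intro γ hγ
    have h : CompLE γ δ := (finite_compLE δ).mem_toFinset.1 hγ
    simpa using h.2
  · intro v hv hv'
    have hv : BruhatLE v (compPerm δ) := by simpa using hv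
    by_cases hmin : ∀ i j, i < j → sorted δ i = sorted δ j → v i < v j
    · obtain ⟨h1, h2⟩ := sorted_comp_inv (sorted_antitone δ) hmin
      exact absurd ⟨_, (finite_compLE δ).mem_toFinset.2 ⟨h1, by rwa [h2]⟩, h2⟩ hv'
    · push Not at hmin
      obtain ⟨p, q, hpq, hl, hle⟩ := hmin
      obtain ⟨i, hi1, hi2⟩ := exists_adjacent_inversion (sorted_antitone δ) hpq hl
        (lt_of_le_of_ne hle fun e => hpq.ne' (v.injective e))
      exact tauHatPerm_eq_zero hi2 (swapVars_xPow hi1)
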